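/- **Conventions.** The functional graph of a map $f:S\to S$ on a finite set is the digraph with vertex set $S$ and arcs $s\to f(s)$. In rooted trees the arcs point towards the root; $\bullet$ is the one-node tree. $\oplus$ is disjoint union of digraphs, $n\times H$ is the disjoint union of $n$ copies of $H$, and $\langle T_1\oplus\cdots\oplus T_r\rangle$ is the rooted tree obtained by adding a new root whose children are the roots of $T_1,\dots,T_r$ (so $\langle\emptyset\rangle=\bullet$). For $m\ge 1$ and a rooted tree $T$, $\operatorname{Cyc}(m,T)$ is the digraph consisting of a directed cycle of length $m$ in which every node is the root of a copy of $T$. $\varphi$ is Euler's totient function and $\operatorname{ord}_d(t)$ the multiplicative order of $t$ modulo $d$ (with $\operatorname{ord}_1(t)=1$). *Elementary trees.* For a non-increasing sequence $v=(v_1,\dots,v_d)$ of positive integers, $d\ge 1$, put $T_v^0=\bullet$, $$T_v^k=\Big\langle v_k\times T_v^{k-1}\oplus\bigoplus_{i=1}^{k-1}(v_i-v_{i+1})\times T_v^{i-1}\Big\rangle\ (1\le k<d),\qquad \mathcal T_v=\Big\langle (v_d-1)\times T_v^{d-1}\oplus\bigoplus_{i=1}^{d-1}(v_i-v_{i+1})\times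 T_v^{i-1}\Big\rangle .$$ *Iterated gcd.* For positive integers $t,n$, $\gcd_t(n)=(v_1,\dots,v_D)$, where $v_1=\gcd(t,n)$, $v_{i+1}=\gcd\big(t,n/(v_1\cdots v_i)\big)$ for $i\ge1$, and $D$ is the least positive integer with $v_{D+1}=1$ (so $\gcd_t(n)=(1)$ if $\gcd(t,n)=1$). *Flower groups.* A $\mu$-subgroup of a group is a cyclic subgroup that is not contained in any other cyclic subgroup. Let $G$ be a finite noncyclic group and $C_1,\dots,C_k$ its distinct $\mu$-subgroups. $G$ is a flower group of type $(c_0;c_1,\dots,c_k)$ if there is a subgroup $C_0$ of $G$ with $C_i\cap C_j=C_0$ for all $1\le i<j\le k$, and $c_i=|C_i|$ for $0\le i\le k$. *Central tree.* For a positive integer $t$ let $\varphi_t:G\to G$, $\varphi_t(g)=g^t$. The central tree $\mathcal T_t(G)$ is the rooted tree attached to the identity $1$ in the functional graph of $\varphi_t$: its nodes are the $g\in G$ whose forward orbit under $\varphi_t$ has $1$ as its first periodic point, its root is $1$, and its arcs are $g\to g^t$ for the nodes $g\neq 1$. **Theorem.** Let $t$ be a positive integer and let $G$ be a flower group of type $(c_0;c_1,\dots,c_k)$.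 For $0\le i\le k$ write $c_i=\nu_i\omega_i$, where $\omega_i$ is the greatest divisor of $c_i$ that is coprime to $t$. Then the functional graph of $\varphi_t:G\to G$, $g\mapsto g^t$, is isomorphic, as a digraph, to $$\left(\bigoplus_{i=1}^k\ \bigoplus_{\substack{d_i\mid\omega_i\\ d_i\nmid\omega_0}}\frac{\varphi(d_i)}{\operatorname{ord}_{d_i}(t)}\times\operatorname{Cyc}\big(\operatorname{ord}_{d_i}(t),\mathcal T_{\gcd_t(\nu_i)}\big)\right)\oplus\left(\bigoplus_{d_0\mid\omega_0}\frac{\varphi(d_0)}{\operatorname{ord}_{d_0}(t)}\times\operatorname{Cyc}\big(\operatorname{ord}_{d_0}(t),\mathcal T_t(G)\big)\right),$$ and the central tree $\mathcal T_t(G)$ has exactly $\sum_{i=1}^k\nu_i-(k-1)\nu_0$ nodes. -/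

import Mathlib

namespace FlowerGroup

universe u v

/-! ### Directed graphs -/

/-- The functional graph of `f`: one arc `s → f s` for every `s`. -/
def functionalGraph {S : Type u} (f : S → S) : Digraph S where
  Adj s s' := f s = s'

/-- The disjoint union of two digraphs. -/
def disjUnion {V : Type u} {W : Type v} (A : Digraph V) (B : Digraph W) : Digraph (V ⊕ W) where
  Adj := Sum.LiftRel A.Adj B.Adj

/-- Adjacency in the disjoint union of a family of digraphs. -/
inductive SigmaAdj {ι : Type u} {V : ι → Type v} (A : ∀ i, Digraph (V i)) :
    (Σ i, V i) → (Σ i, V i) → Prop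
  | mk (i : ι) (x y : V i) : (A i).Adj x y → SigmaAdj A ⟨i, x⟩ ⟨i, y⟩

/-- The disjoint union of a family of digraphs. -/
def disjUnionFamily {ι : Type u} {V : ι → Type v} (A : ∀ i, Digraph (V i)) :
    Digraph (Σ i, V i) where
  Adj := SigmaAdj A

/-- The disjoint union of `n` copies of a digraph. -/
def copies {V : Type u} (n : ℕ) (A : Digraph V) : Digraph (Fin n × V) where
  Adj x y := x.1 = y.1 ∧ A.Adj x.2 y.2

/-- Isomorphism of digraphs. -/
def Isomorphic {V : Type u} {W : Type v} (A : Digraph V) (B : Digraph W) : Prop :=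
  Nonempty (A.Adj ≃r B.Adj)

/-! ### Rooted trees -/

/-- A rooted tree, with arcs directed towards the root: the root has no outgoing arc, no vertex has
two outgoing arcs, and from every vertex there is a directed path to the root. -/
structure RTree where
  /-- the nodes -/
  V : Type u
  /-- the arcs, from a child to its parent -/
  graph : Digraph V
  /-- the root -/
  root : V
  root_sink : ∀ w, ¬ graph.Adj root w
  out_unique : ∀ x y z, graph.Adj x y → graph.Adj x z → y = z
  reach : ∀ x, Relation.ReflTransGen graph.Adj x root

/-- The rooted tree with a single node. -/
def RTree.bullet : RTree.{0} where
  V := Unit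
  graph := ⟨fun _ _ => False⟩
  root := ()
  root_sink _ h := h
  out_unique _ _ _ _ _ := rfl
  reach _ := Relation.ReflTransGen.refl

/-- Adjacency in `⟨⨁ i, T i⟩`; the new root is `none`. -/
inductive JoinAdj {ι : Type} (T : ι → RTree.{0}) :
    Option (Σ i, (T i).V) → Option (Σ i, (T i).V) → Prop
  | inner (i : ι) (x y : (T i).V) : (T i).graph.Adj x y → JoinAdj T (some ⟨i, x⟩) (some ⟨i, y⟩)
  | top (i : ι) : JoinAdj T (some ⟨i, (T i).root⟩) none

/-- The rooted tree `⟨⨁ i, T i⟩`, obtained from the forest with components `T i` by adding a new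
root whose children are the roots of the `T i`. -/
def RTree.join {ι : Type} (T : ι → RTree.{0}) : RTree.{0} where
  V := Option (Σ i, (T i).V)
  graph := ⟨JoinAdj T⟩
  root := none
  root_sink := by
    intro w h
    cases h
  out_unique := by
    intro x y z h1 h2
    cases h1 with
    | inner i x y h =>
      cases h2 with
      | inner _ _ z h' => rw [(T i).out_unique x y z h h']
      | top _ => exact absurd h ((T i).root_sink y)
    | top i =>
      cases h2 with
      | inner _ _ z h' => exact absurd h' ((T i).root_sink z)
      | top _ => rfl
  reach := by
    rintro (_ | ⟨i, x⟩)
    · exact Relation.ReflTransGen.refl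
    · have h : Relation.ReflTransGen (JoinAdj T) (some ⟨i, x⟩) (some ⟨i, (T i).root⟩) :=
        Relation.ReflTransGen.lift (fun z => some (⟨i, z⟩ : Σ i, (T i).V))
          (fun a b hab => JoinAdj.inner i a b hab) _ _ ((T i).reach x)
      exact h.tail (JoinAdj.top i)

/-- The digraph `Cyc(m, T)` for `m ≥ 1`: a directed `m`-cycle, whose nodes are indexed by `ZMod m`,
in which every node is the root of a copy of the rooted tree `T`. -/
def cyc (m : ℕ) (T : RTree.{u}) : Digraph (ZMod m × T.V) where
  Adj x y := (x.1 = y.1 ∧ T.graph.Adj x.2 y.2) ∨ (x.2 = T.root ∧ y.2 = T.root ∧ y.1 = x.1 + 1)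

/-- The auxiliary trees `T_ν^k` of an elementary tree. The sequence `(ν_1, ν_2, …)` is indexed from
zero: `ν i` stands for `ν_{i+1}`. Thus `T_ν^0 = •` and
`T_ν^{k+1} = ⟨ν_{k+1} × T_ν^k ⊕ ⨁_{i < k} (ν_{i+1} - ν_{i+2}) × T_ν^i⟩`. -/
def elementarySubtree (ν : ℕ → ℕ) : ℕ → RTree.{0}
  | 0 => RTree.bullet
  | k + 1 => RTree.join
      (ι := Fin (ν k) ⊕ (Σ i : Fin k, Fin (ν i - ν (i + 1))))
      (Sum.elim (fun _ => elementarySubtree ν k) (fun p => elementarySubtree ν p.1.1))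
  termination_by k => k
  decreasing_by
    · exact Nat.lt_succ_self k
    · exact Nat.lt_succ_of_lt p.1.2

/-- The elementary tree `T_ν` of a non-increasing sequence `ν = (ν_1, …, ν_d)` of positive integers
with `d ≥ 1` terms; again `ν i` stands for `ν_{i+1}` and only `ν 0, …, ν (d - 1)` are used.
With `d = e + 1`, `T_ν = ⟨(ν_d - 1) × T_ν^{d-1} ⊕ ⨁_{i < d - 1} (ν_{i+1} - ν_{i+2}) × T_ν^i⟩`. -/
def elementaryTree (ν : ℕ → ℕ) : ℕ → RTree.{0}
  | 0 => RTree.bullet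
  | e + 1 => RTree.join
      (ι := Fin (ν e - 1) ⊕ (Σ i : Fin e, Fin (ν i - ν (i + 1))))
      (Sum.elim (fun _ => elementarySubtree ν e) (fun p => elementarySubtree ν p.1.1))

/-! ### The iterated gcd -/

/-- `gcdRem t n i = n / (ν_1 ⋯ ν_i)`, where `ν_{i+1} = gcd(t, n / (ν_1 ⋯ ν_i))`. -/
def gcdRem (t n : ℕ) : ℕ → ℕ
  | 0 => n
  | i + 1 => gcdRem t n i / Nat.gcd t (gcdRem t n i)

/-- The terms of the iterated gcd of `n` relative to `t`, indexed from zero: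
`gcdSeq t n i = ν_{i+1}`. -/
def gcdSeq (t n i : ℕ) : ℕ := Nat.gcd t (gcdRem t n i)

/-- The length `D` of the iterated gcd: the least positive `D` with `ν_{D+1} = 1`
(if `gcd(t, n) = 1` then `D = 1`, and the sequence is `(1)`). -/
noncomputable def gcdLength (t n : ℕ) : ℕ := sInf {D | 0 < D ∧ gcdSeq t n D = 1}

/-- The elementary tree `T_{gcd_t(n)}`. -/
noncomputable def gcdTree (t n : ℕ) : RTree.{0} := elementaryTree (gcdSeq t n) (gcdLength t n)

/-! ### Trees attached to periodic points -/

/-- `y` belongs to the tree attached to the periodic point `x`: the orbit of `y` under `f` reaches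
`x`, and `x` is the first periodic point on it. -/
def InAttachedTree {S : Type u} (f : S → S) (x y : S) : Prop :=
  ∃ n, f^[n] y = x ∧ ∀ m < n, f^[m] y ∉ Function.periodicPts f

/-- The rooted tree attached to the periodic point `x` in the functional graph of `f`. -/
def attachedTree {S : Type u} (f : S → S) (x : S) : RTree.{u} where
  V := {y : S // InAttachedTree f x y}
  graph := ⟨fun y z => y.1 ≠ x ∧ f y.1 = z.1⟩
  root := ⟨x, 0, rfl, fun _ hm => absurd hm (Nat.not_lt_zero _)⟩
  root_sink _ h := h.1 rfl
  out_unique _ _ _ h1 h2 := Subtype.ext (h1.2.symm.trans h2.2)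
  reach := by
    rintro ⟨y, n, hn, hm⟩
    induction n generalizing y with
    | zero =>
      have hy : y = x := hn
      subst hy
      exact Relation.ReflTransGen.refl
    | succ n ih =>
      by_cases hy : y = x
      · subst hy
        exact Relation.ReflTransGen.refl
      · have h1 : f^[n] (f y) = x := by rwa [Function.iterate_succ_apply] at hn
        have h2 : ∀ m < n, f^[m] (f y) ∉ Function.periodicPts f := by
          intro m hmn
          rw [← Function.iterate_succ_apply]
          exact hm (m + 1) (Nat.succ_lt_succ hmn)
        exact Relation.ReflTransGen.head ⟨hy, rfl⟩ (ih (f y) h1 h2)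

/-- The power map `g ↦ g ^ t`. -/
def powerMap (G : Type u) [Group G] (t : ℕ) : G → G := fun g => g ^ t

/-- The central tree `T_t(G)`: the tree attached to the identity in the functional graph of the
power map `g ↦ g ^ t`. -/
def centralTree (t : ℕ) (G : Type u) [Group G] : RTree.{u} := attachedTree (powerMap G t) 1

/-! ### Flower groups -/

/-- A `μ`-subgroup is a maximal cyclic subgroup. -/
def IsMuSubgroup {G : Type u} [Group G] (H : Subgroup G) : Prop :=
  IsCyclic H ∧ ∀ K : Subgroup G, IsCyclic K → H ≤ K → K = H

/-- `G` is a flower group with pistil `C₀` and petals `C 0, …, C (k - 1)`, listed without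
repetition: `G` is finite and noncyclic, the petals are exactly the `μ`-subgroups of `G`, and any
two distinct petals intersect in `C₀`. -/
structure IsFlower {G : Type u} [Group G] {k : ℕ} (C₀ : Subgroup G) (C : Fin k → Subgroup G) :
    Prop where
  finite : Finite G
  not_cyclic : ¬ IsCyclic G
  injective : Function.Injective C
  petal_iff : ∀ H : Subgroup G, IsMuSubgroup H ↔ ∃ i, C i = H
  inter : ∀ i j, i ≠ j → C i ⊓ C j = C₀

/-- `G` is a flower group of type `(c₀; c 0, …, c (k - 1))`. -/
def IsFlowerGroupOfType (G : Type u) [Group G] {k : ℕ} (c₀ : ℕ) (c : Fin k → ℕ) : Prop :=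
  ∃ (C₀ : Subgroup G) (C : Fin k → Subgroup G), IsFlower C₀ C ∧
    Nat.card C₀ = c₀ ∧ ∀ i, Nat.card (C i) = c i

/-- `ω` is the greatest divisor of `c` that is relatively prime with `t`. -/
def IsCoprimePart (t c ω : ℕ) : Prop := IsGreatest {d : ℕ | d ∣ c ∧ Nat.Coprime d t} ω

/-- The multiplicative order `ord_d(t)` of `t` modulo `d`. -/
noncomputable def ordMod (d t : ℕ) : ℕ := orderOf (t : ZMod d)

/-- The digraph `(φ(d) / ord_d(t)) × Cyc(ord_d(t), T)`. -/
noncomputable def cycleBlock (t d : ℕ) (T : RTree.{u}) :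
    Digraph (Fin (Nat.totient d / ordMod d t) × (ZMod (ordMod d t) × T.V)) :=
  copies (Nat.totient d / ordMod d t) (cyc (ordMod d t) T)

end FlowerGroup

/-!
Let `p` be the power map and send `g` to its `t`-regular part `w`, an iterate of `p` applied to `g`
that is periodic, hence of order prime to `t`; the cofactor `g * w⁻¹` commutes with `w` and is
killed by an iterate of `p`, so it lies in the central tree. Multiplication of the two factors is
compatible with `p`, so the functional graph splits into one block for every order `d` of `w`. The
elements of order `d` of a cyclic group form `φ(d) / ord_d(t)` cycles of length `ord_d(t)`. For `w`
in the pistil, which is central, every element of the central tree occurs as a cofactor; for `w` in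
exactly one petal, only those in this petal do, and they form the tree at the identity of the power
map of a cyclic group. This tree is elementary because the number of preimages of a vertex among the
endpoints of paths of length `j` is either zero or a number depending on `j` alone, which for a
cyclic group is an entry of the iterated gcd. The node count is inclusion-exclusion over the petals,
each of which contains `ν` elements killed by an iterate of `p`.
-/

namespace FlowerGroup

open Function

/-! ### Digraphs realized inside functional graphs -/

/-- The digraph `A` is a copy of the part of the functional graph of `f` that is carried by `X`.
Since every vertex of `A` has an outgoing arc, it is enough that arcs of `A` are mapped to arcs. -/
structure Realizes {V : Type*} {S : Type*} (A : Digraph V) (f : S → S) (X : Set S) : Prop where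
  exists_adj : ∀ x, ∃ y, A.Adj x y
  exists_map : ∃ F : V → S, Injective F ∧ (∀ x y, A.Adj x y → f (F x) = F y) ∧ Set.range F = X

namespace Realizes

variable {S : Type*} {f : S → S}

theorem isomorphic {V : Type*} {A : Digraph V} (h : Realizes A f Set.univ) :
    Isomorphic (functionalGraph f) A := by
  obtain ⟨hA, F, hF, hadj, hrange⟩ := h
  let e : V ≃ S := Equiv.ofBijective F ⟨hF, Set.range_eq_univ.mp hrange⟩
  refine ⟨RelIso.symm ⟨e, fun {x y} => ⟨fun hxy => ?_, hadj x y⟩⟩⟩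
  obtain ⟨z, hz⟩ := hA x
  rwa [← hF ((hadj x z hz).symm.trans hxy)]

theorem map {S' V : Type*} {A : Digraph V} {X : Set S} {f' : S' → S'} {e : S → S'}
    (hA : Realizes A f X) (he : Set.InjOn e X) (hef : ∀ x ∈ X, e (f x) = f' (e x)) :
    Realizes A f' (e '' X) := by
  obtain ⟨hA, F, hF, hadj, rfl⟩ := hA
  refine ⟨hA, e ∘ F, fun x y hxy => hF (he ⟨x, rfl⟩ ⟨y, rfl⟩ hxy), fun x y hxy => ?_,
    Set.range_comp e F⟩
  rw [comp_apply, ← hef _ ⟨x, rfl⟩, hadj x y hxy, comp_apply]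

theorem disjUnion {V W : Type*} {A : Digraph V} {B : Digraph W} {X Y : Set S}
    (hA : Realizes A f X) (hB : Realizes B f Y) (hXY : Disjoint X Y) :
    Realizes (disjUnion A B) f (X ∪ Y) := by
  obtain ⟨hA, F, hF, hFadj, rfl⟩ := hA
  obtain ⟨hB, F', hF', hFadj', rfl⟩ := hB
  refine ⟨?_, Sum.elim F F', ?_, ?_, Set.Sum.elim_range F F'⟩
  · rintro (x | x)
    · exact (hA x).imp' Sum.inl fun _ => Sum.LiftRel.inl
    · exact (hB x).imp' Sum.inr fun _ => Sum.LiftRel.inr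
  · exact hF.sumElim hF' fun a b hab => Set.disjoint_left.mp hXY ⟨a, rfl⟩ ⟨b, hab.symm⟩
  · rintro _ _ (h | h)
    · exact hFadj _ _ h
    · exact hFadj' _ _ h

theorem disjUnionFamily {ι : Type*} {V : ι → Type*} {A : ∀ i, Digraph (V i)} {X : ι → Set S}
    (hA : ∀ i, Realizes (A i) f (X i)) (hX : Pairwise (Disjoint on X)) :
    Realizes (disjUnionFamily A) f (⋃ i, X i) := by
  choose F hF hadj hrange using fun i => (hA i).exists_map
  refine ⟨?_, fun p => F p.1 p.2, ?_, ?_, ?_⟩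
  · rintro ⟨i, x⟩
    exact ((hA i).exists_adj x).imp' (Sigma.mk i) fun y => SigmaAdj.mk i x y
  · rintro ⟨i, x⟩ ⟨j, y⟩ (hxy : F i x = F j y)
    obtain rfl : i = j := hX.eq <| Set.not_disjoint_iff.mpr
      ⟨F i x, hrange i ▸ ⟨x, rfl⟩, hrange j ▸ ⟨y, hxy.symm⟩⟩
    rw [hF i hxy]
  · rintro _ _ ⟨i, x, y, h⟩
    exact hadj i x y h
  · simp only [← hrange]
    exact Set.range_sigma_eq_iUnion_range _

end Realizes

theorem RTree.exists_adj (T : RTree) {x : T.V} (hx : x ≠ T.root) : ∃ y, T.graph.Adj x y := by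
  rcases (T.reach x).cases_head with h | ⟨y, hy, -⟩
  · exact absurd h hx
  · exact ⟨y, hy⟩

theorem exists_cyc_adj (m : ℕ) (T : RTree) (x : ZMod m × T.V) : ∃ y, (cyc m T).Adj x y := by
  by_cases hx : x.2 = T.root
  · exact ⟨(x.1 + 1, T.root), Or.inr ⟨hx, rfl, rfl⟩⟩
  · exact (T.exists_adj hx).imp' (Prod.mk x.1) fun _ hy => Or.inl ⟨rfl, hy⟩

/-! ### Trees realized inside functional graphs -/

/-- The rooted tree `T` is a copy of the part of the functional graph of `f` that is carried by `X`,
apart from the arc leaving `r`, the image of the root. -/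
def RTree.Realizes {S : Type*} (T : RTree) (f : S → S) (r : S) (X : Set S) : Prop :=
  ∃ F : T.V → S, Injective F ∧ F T.root = r ∧ (∀ x y, T.graph.Adj x y → f (F x) = F y) ∧
    Set.range F = X

theorem RTree.Realizes.map {S : Type*} {S' : Type*} {T : RTree} {f : S → S} {f' : S' → S'} {r : S}
    {X : Set S} (hT : T.Realizes f r X) {e : S → S'} (he : Injective e) (hef : Semiconj e f f') :
    T.Realizes f' (e r) (e '' X) := by
  obtain ⟨F, hF, hroot, hadj, rfl⟩ := hT
  refine ⟨e ∘ F, he.comp hF, congrArg e hroot, fun x y hxy => ?_, Set.range_comp e F⟩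
  rw [comp_apply, ← hef (F x), hadj x y hxy, comp_apply]

theorem RTree.Realizes.card_eq {S : Type*} {T : RTree} {f : S → S} {r : S} {X : Set S}
    (hT : T.Realizes f r X) : Nat.card T.V = X.ncard := by
  obtain ⟨F, hF, -, -, rfl⟩ := hT
  exact (Set.ncard_range_of_injective hF).symm

/-- The vertices whose forward orbit under `f` passes through `r`. -/
def backwardOrbit {S : Type*} (f : S → S) (r : S) : Set S := {y | ∃ n, f^[n] y = r}

theorem self_mem_backwardOrbit {S : Type*} (f : S → S) (r : S) : r ∈ backwardOrbit f r := ⟨0, rfl⟩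

section Preimages

variable {S ι : Type*} {f : S → S} {r : S} {e : ι → S}

theorem mem_backwardOrbit_or_mem {y a b : S} (ha : y ∈ backwardOrbit f a)
    (hb : y ∈ backwardOrbit f b) : a ∈ backwardOrbit f b ∨ b ∈ backwardOrbit f a := by
  obtain ⟨n, rfl⟩ := ha
  obtain ⟨m, rfl⟩ := hb
  rcases le_total n m with h | h
  · exact Or.inl ⟨m - n, by rw [← iterate_add_apply, Nat.sub_add_cancel h]⟩
  · exact Or.inr ⟨n - m, by rw [← iterate_add_apply, Nat.sub_add_cancel h]⟩

theorem pairwise_disjoint_backwardOrbit (he : Injective e) (hf : ∀ i, f (e i) = r)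
    (hr : ∀ i, r ∉ backwardOrbit f (e i)) :
    Pairwise (Disjoint on fun i => backwardOrbit f (e i)) := by
  have key : ∀ i j, e i ∈ backwardOrbit f (e j) → i = j := by
    rintro i j ⟨_ | n, hn⟩
    · exact he hn
    · exact absurd ⟨n, by rwa [iterate_succ_apply, hf] at hn⟩ (hr j)
  intro i j hij
  refine Set.disjoint_left.mpr fun y hi hj => hij ?_
  rcases mem_backwardOrbit_or_mem hi hj with h | h
  · exact key i j h
  · exact (key j i h).symm

theorem backwardOrbit_eq_insert_iUnion (hf : ∀ i, f (e i) = r)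
    (hsurj : ∀ y, f y = r → y ≠ r → ∃ i, e i = y) :
    backwardOrbit f r = insert r (⋃ i, backwardOrbit f (e i)) := by
  ext y
  simp only [Set.mem_insert_iff, Set.mem_iUnion]
  constructor
  · rintro ⟨n, hn⟩
    induction n with
    | zero => exact Or.inl hn
    | succ n ih =>
      by_cases hc : f^[n] y = r
      · exact ih hc
      · rw [iterate_succ_apply'] at hn
        obtain ⟨i, hi⟩ := hsurj _ hn hc
        exact Or.inr ⟨i, n, hi.symm⟩
  · rintro (rfl | ⟨i, n, hn⟩)
    · exact self_mem_backwardOrbit f y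
    · exact ⟨n + 1, by rw [iterate_succ_apply', hn, hf]⟩

end Preimages

theorem RTree.Realizes.join {S : Type*} {f : S → S} {ι : Type} {T : ι → RTree.{0}} {e : ι → S}
    {r : S} (hT : ∀ i, (T i).Realizes f (e i) (backwardOrbit f (e i))) (he : Injective e)
    (hf : ∀ i, f (e i) = r) (hsurj : ∀ y, f y = r → y ≠ r → ∃ i, e i = y)
    (hr : ∀ i, r ∉ backwardOrbit f (e i)) : (RTree.join T).Realizes f r (backwardOrbit f r) := by
  choose F hF hroot hadj hrange using hT
  have hmem : ∀ i x, F i x ∈ backwardOrbit f (e i) := fun i x => hrange i ▸ ⟨x, rfl⟩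
  refine ⟨fun x => x.elim r fun p => F p.1 p.2, ?_, rfl, ?_, ?_⟩
  · refine Option.injective_iff.mpr ⟨?_, ?_⟩
    · rintro ⟨i, x⟩ ⟨j, y⟩ (hxy : F i x = F j y)
      obtain rfl : i = j := (pairwise_disjoint_backwardOrbit he hf hr).eq <|
        Set.not_disjoint_iff.mpr ⟨F i x, hmem i x, hxy ▸ hmem j y⟩
      rw [hF i hxy]
    · rintro ⟨⟨i, x⟩, hx : F i x = r⟩
      exact hr i (hx ▸ hmem i x)
  · rintro _ _ (⟨i, x, y, h⟩ | i)
    · exact hadj i x y h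
    · exact (congrArg f (hroot i)).trans (hf i)
  · refine (Option.range_elim r fun p : Σ i, (T i).V => F p.1 p.2).trans ?_
    rw [Set.range_sigma_eq_iUnion_range, backwardOrbit_eq_insert_iUnion hf hsurj]
    simp only [hrange]

/-! ### Elementary trees -/

/-- The vertices of height `j`: those at the end of a path of length `j` of the functional graph
of `f`, but not of a path of length `j + 1`. -/
def heightLevel {S : Type*} (f : S → S) (j : ℕ) : Set S :=
  Set.range f^[j] \ Set.range f^[j + 1]

/-- The map `f` is level regular with degrees `v` if a vertex at the end of a path of length `j + 1`
always has exactly `v j` preimages that are at the end of a path of length `j`. -/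
def IsLevelRegular {S : Type*} (f : S → S) (v : ℕ → ℕ) : Prop :=
  ∀ j, ∀ u ∈ Set.range f^[j + 1], (f ⁻¹' {u} ∩ Set.range f^[j]).ncard = v j

theorem exists_enumeration_sum_sigma {S : Type*} [Finite S] {P : ℕ → Set S}
    (hP : Pairwise (Disjoint on P)) {N : ℕ → ℕ} {n k : ℕ} (hN : ∀ i < k, (P i).ncard = N i)
    (hn : (P k).ncard = n) :
    ∃ e : Fin n ⊕ (Σ i : Fin k, Fin (N i)) → S, Injective e ∧ (∀ x, e (Sum.inl x) ∈ P k) ∧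
      (∀ p, e (Sum.inr p) ∈ P p.1) ∧ ∀ i ≤ k, P i ⊆ Set.range e := by
  let a : Fin n ≃ P k := (Finite.equivFinOfCardEq hn).symm
  let b (i : Fin k) : Fin (N i) ≃ P i := (Finite.equivFinOfCardEq (hN i i.2)).symm
  have hdisj : ∀ {i j : ℕ} {x : S}, x ∈ P i → x ∈ P j → i = j := fun hi hj =>
    hP.eq (Set.not_disjoint_iff.mpr ⟨_, hi, hj⟩)
  refine ⟨Sum.elim (fun x => a x) fun p => b p.1 p.2, ?_, fun x => (a x).2,
    fun p => (b p.1 p.2).2, fun i hi x hx => ?_⟩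
  · refine (Subtype.val_injective.comp a.injective).sumElim ?_ ?_
    · rintro ⟨i, x⟩ ⟨j, y⟩ (hxy : (b i x : S) = b j y)
      obtain rfl : i = j := Fin.ext (hdisj (b i x).2 (hxy ▸ (b j y).2))
      rw [(b i).injective (Subtype.ext hxy)]
    · rintro x ⟨i, y⟩ (hxy : (a x : S) = b i y)
      exact i.2.ne' (hdisj (a x).2 (hxy ▸ (b i y).2))
  · rcases hi.eq_or_lt with rfl | hi
    · exact ⟨Sum.inl (a.symm ⟨x, hx⟩), by simp⟩
    · exact ⟨Sum.inr ⟨⟨i, hi⟩, (b ⟨i, hi⟩).symm ⟨x, hx⟩⟩, by simp⟩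

section

variable {S : Type*} {f : S → S}

theorem antitone_range_iterate (f : S → S) : Antitone fun j => Set.range f^[j] := by
  refine antitone_nat_of_succ_le fun j => ?_
  rw [iterate_succ]
  exact Set.range_comp_subset_range f f^[j]

theorem iterate_mem_range_iterate {j : ℕ} {u : S} (hu : u ∈ Set.range f^[j]) (n : ℕ) :
    f^[n] u ∈ Set.range f^[j] := by
  obtain ⟨x, rfl⟩ := hu
  exact ⟨f^[n] x, by rw [← iterate_add_apply, ← iterate_add_apply, add_comm]⟩

theorem pairwise_disjoint_heightLevel (f : S → S) : Pairwise (Disjoint on heightLevel f) := by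
  refine (symm_disjoint.comap _).pairwise_on _ |>.mpr fun i j hij => ?_
  exact Set.disjoint_left.mpr fun u hi hj => hi.2 (antitone_range_iterate f hij hj.1)

theorem exists_mem_heightLevel {k : ℕ} {u : S} (hu : u ∉ Set.range f^[k + 1]) :
    ∃ i ≤ k, u ∈ heightLevel f i := by
  induction k with
  | zero => exact ⟨0, le_rfl, ⟨u, rfl⟩, hu⟩
  | succ k ih =>
    by_cases hk : u ∈ Set.range f^[k + 1]
    · exact ⟨k + 1, le_rfl, hk, hu⟩
    · obtain ⟨i, hi, h⟩ := ih hk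
      exact ⟨i, hi.trans k.le_succ, h⟩

theorem notMem_range_iterate_of_mem_heightLevel {i k : ℕ} {u : S} (hu : u ∈ heightLevel f i)
    (hik : i ≤ k) : u ∉ Set.range f^[k + 1] := fun h =>
  hu.2 (antitone_range_iterate f (Nat.succ_le_succ hik) h)

theorem backwardOrbit_eq_singleton {r : S} (hr : r ∈ heightLevel f 0) :
    backwardOrbit f r = {r} := by
  ext y
  constructor
  · rintro ⟨_ | n, hn⟩
    · exact hn
    · exact absurd ⟨f^[n] y, by rwa [iterate_succ_apply'] at hn⟩ hr.2
  · rintro rfl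
    exact self_mem_backwardOrbit f y

theorem RTree.bullet_realizes (f : S → S) (r : S) : RTree.bullet.Realizes f r {r} :=
  ⟨fun _ => r, fun _ _ _ => rfl, rfl, fun _ _ h => h.elim, Set.range_const (ι := Unit)⟩

variable [Finite S]

theorem RTree.join_realizes_of_heights {T : ℕ → RTree.{0}} {N : ℕ → ℕ} {n k : ℕ} {r : S}
    (hT : ∀ i ≤ k, ∀ u ∈ heightLevel f i, (T i).Realizes f u (backwardOrbit f u))
    (hN : ∀ i < k, (f ⁻¹' {r} ∩ heightLevel f i).ncard = N i)
    (hn : (f ⁻¹' {r} ∩ heightLevel f k).ncard = n)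
    (hpre : ∀ y, f y = r → y ≠ r → y ∉ Set.range f^[k + 1]) (hr : r ∈ Set.range f^[k + 1]) :
    (RTree.join (ι := Fin n ⊕ (Σ i : Fin k, Fin (N i)))
      (Sum.elim (fun _ => T k) fun p => T p.1.1)).Realizes f r (backwardOrbit f r) := by
  have hdisj : Pairwise (Disjoint on fun i => f ⁻¹' {r} ∩ heightLevel f i) := fun i j hij =>
    (pairwise_disjoint_heightLevel f hij).mono Set.inter_subset_right Set.inter_subset_right
  obtain ⟨e, he, hinl, hinr, hsurj⟩ := exists_enumeration_sum_sigma hdisj hN hn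
  have hheight : ∀ x, ∃ i ≤ k, e x ∈ f ⁻¹' {r} ∩ heightLevel f i := by
    rintro (x | p)
    · exact ⟨k, le_rfl, hinl x⟩
    · exact ⟨p.1, p.1.2.le, hinr p⟩
  refine RTree.Realizes.join (e := e) ?_ he (fun x => ?_) (fun y hy hyr => ?_) ?_
  · rintro (x | p)
    · exact hT k le_rfl _ (hinl x).2
    · exact hT p.1 p.1.2.le _ (hinr p).2
  · obtain ⟨i, -, hi⟩ := hheight x
    exact hi.1
  · obtain ⟨i, hi, hyi⟩ := exists_mem_heightLevel (hpre y hy hyr)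
    exact hsurj i hi ⟨hy, hyi⟩
  · rintro x ⟨m, hm⟩
    obtain ⟨i, hi, hxi⟩ := hheight x
    exact notMem_range_iterate_of_mem_heightLevel hxi.2 hi (hm ▸ iterate_mem_range_iterate hr m)

variable {v : ℕ → ℕ}

theorem IsLevelRegular.ncard_preimage_inter_heightLevel (hv : IsLevelRegular f v) {j : ℕ} {u : S}
    (hu : u ∈ Set.range f^[j + 2]) : (f ⁻¹' {u} ∩ heightLevel f j).ncard = v j - v (j + 1) := by
  rw [← hv j u (antitone_range_iterate f (Nat.le_succ _) hu), ← hv (j + 1) u hu,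
    ← Set.ncard_sdiff (Set.inter_subset_inter_right _ (antitone_range_iterate f j.le_succ)),
    ← Set.inter_sdiff_distrib_left]
  rfl

theorem IsLevelRegular.elementarySubtree_realizes (hv : IsLevelRegular f v) {h : ℕ} {u : S}
    (hu : u ∈ heightLevel f h) :
    (elementarySubtree v h).Realizes f u (backwardOrbit f u) := by
  induction h using Nat.strong_induction_on generalizing u with
  | _ h ih =>
  cases h with
  | zero =>
    rw [elementarySubtree, backwardOrbit_eq_singleton hu]
    exact RTree.bullet_realizes f u
  | succ k =>
    have hpre : ∀ y, f y = u → y ∉ Set.range f^[k + 1] := by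
      rintro _ rfl ⟨x, rfl⟩
      exact hu.2 ⟨x, iterate_succ_apply' f _ x⟩
    have hn : (f ⁻¹' {u} ∩ heightLevel f k).ncard = v k := by
      rw [← hv k u hu.1]
      congr 1
      exact Set.ext fun y => and_congr_right fun hy => and_iff_left (hpre y hy)
    rw [elementarySubtree]
    exact RTree.join_realizes_of_heights (fun i hi _ => ih i (Nat.lt_succ_of_le hi))
      (fun i hi => hv.ncard_preimage_inter_heightLevel
        (antitone_range_iterate f (Nat.succ_le_succ hi) hu.1)) hn (fun y hy _ => hpre y hy) hu.1

theorem IsLevelRegular.elementaryTree_realizes (hv : IsLevelRegular f v) {e : ℕ} {r : S}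
    (hr : IsFixedPt f r) (he : 0 < e) (hve : v e = 1) :
    (elementaryTree v e).Realizes f r (backwardOrbit f r) := by
  obtain ⟨e, rfl⟩ := Nat.exists_eq_add_of_lt he
  rw [zero_add] at hve ⊢
  have hrange : ∀ j, r ∈ Set.range f^[j] := fun j => ⟨r, hr.iterate j⟩
  rw [elementaryTree]
  refine RTree.join_realizes_of_heights (fun i _ _ => hv.elementarySubtree_realizes)
    (fun i _ => hv.ncard_preimage_inter_heightLevel (hrange _)) ?_ (fun y hy hyr hmem => ?_)
    (hrange _)
  · rw [hv.ncard_preimage_inter_heightLevel (hrange _), hve]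
  · have hone := (hv _ r (hrange _)).trans hve
    exact hyr (Set.ncard_le_one_iff_subsingleton.mp hone.le ⟨hy, hmem⟩ ⟨hr, hrange _⟩)

end

/-! ### Recurrence in finite functional graphs -/

section

variable {S : Type*} {f : S → S}

theorem iterate_mem_periodicPts_of_card_le [Finite S] {n : ℕ} (hn : Nat.card S ≤ n) (x : S) :
    f^[n] x ∈ periodicPts f := by
  have := Fintype.ofFinite S
  obtain ⟨i, j, hij, hf⟩ := Fintype.exists_ne_map_eq_of_card_lt
    (fun i : Fin (Nat.card S + 1) => f^[i] x) (by simp)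
  wlog hlt : i < j generalizing i j
  · exact this j i hij.symm hf.symm (hij.lt_or_gt.resolve_left hlt)
  have hi : f^[i] x ∈ periodicPts f := mk_mem_periodicPts (Nat.sub_pos_of_lt hlt) <| by
    rw [IsPeriodicPt, IsFixedPt, ← iterate_add_apply, Nat.sub_add_cancel hlt.le]
    exact hf.symm
  rw [← Nat.sub_add_cancel ((Nat.lt_succ_iff.mp i.2).trans hn), iterate_add_apply]
  exact (bijOn_periodicPts f).mapsTo.iterate _ hi

theorem eq_of_mem_periodicPts_of_mem_backwardOrbit {p r : S} (hr : IsFixedPt f r)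
    (hp : p ∈ periodicPts f) (hpr : p ∈ backwardOrbit f r) : p = r := by
  obtain ⟨k, hk, hk'⟩ := hp
  obtain ⟨n, rfl⟩ := hpr
  have hkn : k * n = (k * n - n) + n := (Nat.sub_add_cancel (Nat.le_mul_of_pos_left n hk)).symm
  calc p = f^[k * n] p := (hk'.mul_const n).symm
    _ = f^[k * n - n] (f^[n] p) := by rw [hkn, iterate_add_apply, Nat.add_sub_cancel]
    _ = f^[n] p := hr.iterate _

theorem attachedTree_realizes {S : Type*} {f : S → S} {r : S} (hr : IsFixedPt f r) :
    (attachedTree f r).Realizes f r (backwardOrbit f r) := by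
  classical
  refine ⟨Subtype.val, Subtype.val_injective, rfl, fun x y h => h.2, ?_⟩
  refine Subtype.range_val.trans <| Set.Subset.antisymm (fun y ⟨n, hn, _⟩ => ⟨n, hn⟩)
    fun y (hy : ∃ n, f^[n] y = r) => ?_
  refine ⟨Nat.find hy, Nat.find_spec hy, fun m hm hper => Nat.find_min hy hm ?_⟩
  refine eq_of_mem_periodicPts_of_mem_backwardOrbit hr hper ⟨Nat.find hy - m, ?_⟩
  rw [← iterate_add_apply, Nat.sub_add_cancel hm.le, Nat.find_spec hy]

/-- The number of steps after which the orbit of `y` first meets `r` (`0` if it never does). -/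
noncomputable def hittingTime (f : S → S) (r y : S) : ℕ := sInf {n | f^[n] y = r}

theorem hittingTime_eq_add_one {r y : S} (hy : y ∈ backwardOrbit f r) (hyr : y ≠ r) :
    hittingTime f r y = hittingTime f r (f y) + 1 := by
  have h0 : 1 ≤ sInf {n | f^[n] y = r} :=
    Nat.one_le_iff_ne_zero.mpr fun h =>
      (Nat.sInf_eq_zero.mp h).elim hyr (Set.Nonempty.ne_empty hy)
  exact (Nat.sInf_add h0).symm

/-- The iterate of `f` with exponent `(#S)!`. For finite `S` it maps `S` onto the set of periodic
points of `f` and fixes each of them. -/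
noncomputable def recurrentPart (f : S → S) : S → S := f^[(Nat.card S).factorial]

variable [Finite S]

theorem recurrentPart_mem_periodicPts (f : S → S) (x : S) : recurrentPart f x ∈ periodicPts f :=
  iterate_mem_periodicPts_of_card_le (Nat.self_le_factorial _) x

theorem recurrentPart_eq_self_iff {x : S} : recurrentPart f x = x ↔ x ∈ periodicPts f := by
  have := Fintype.ofFinite S
  rw [mem_periodicPts_iff_isPeriodicPt_factorial_card, ← Nat.card_eq_fintype_card]
  rfl

theorem recurrentPart_eq_iff_mem_backwardOrbit {r y : S} (hr : IsFixedPt f r) :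
    recurrentPart f y = r ↔ y ∈ backwardOrbit f r := by
  refine ⟨fun h => ⟨_, h⟩, fun ⟨n, hn⟩ => ?_⟩
  refine eq_of_mem_periodicPts_of_mem_backwardOrbit hr (recurrentPart_mem_periodicPts f y) ⟨n, ?_⟩
  rw [recurrentPart, ← iterate_add_apply, add_comm, iterate_add_apply, hn]
  exact hr.iterate _

end

theorem exists_equiv_prod_zmod {W : Type*} [Finite W] {f : W → W} {m : ℕ} (hm : 0 < m)
    (hf : ∀ w, minimalPeriod f w = m) :
    ∃ o : Fin (Nat.card W / m) × ZMod m ≃ W, ∀ i j, o (i, j + 1) = f (o (i, j)) := by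
  have : NeZero m := ⟨hm.ne'⟩
  have hmod : ∀ n w, f^[n % m] w = f^[n] w := fun n w => by
    rw [← hf w, iterate_mod_minimalPeriod_eq]
  let : AddAction (ZMod m) W :=
    { vadd := fun j w => f^[j.val] w
      zero_vadd := fun w => by
        change f^[(0 : ZMod m).val] w = w
        rw [ZMod.val_zero, iterate_zero_apply]
      add_vadd := fun i j w => by
        change f^[(i + j).val] w = f^[i.val] (f^[j.val] w)
        rw [ZMod.val_add, hmod, iterate_add_apply] }
  have hfree : ∀ w : W, AddAction.stabilizer (ZMod m) w = ⊥ := by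
    refine fun w => (AddSubgroup.eq_bot_iff_forall _).mpr fun j hj => ?_
    refine (ZMod.val_eq_zero j).mp ?_
    have hper : IsPeriodicPt f j.val w := hj
    exact Nat.eq_zero_of_dvd_of_lt (hf w ▸ hper.minimalPeriod_dvd) (ZMod.val_lt j)
  let Φ := AddAction.selfEquivOrbitsQuotientProd hfree
  have hcard : Nat.card (Quotient (AddAction.orbitRel (ZMod m) W)) = Nat.card W / m := by
    rw [Nat.card_congr Φ, Nat.card_prod, Nat.card_zmod, Nat.mul_div_cancel _ hm]
  let ε := (Finite.equivFinOfCardEq hcard).symm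
  refine ⟨(ε.prodCongr (Equiv.refl _)).trans Φ.symm, fun i j => ?_⟩
  calc (j + 1) +ᵥ (ε i).out = (1 : ZMod m) +ᵥ (j +ᵥ (ε i).out) := by rw [add_comm, add_vadd]
    _ = f^[(1 : ZMod m).val] (j +ᵥ (ε i).out) := rfl
    _ = f (j +ᵥ (ε i).out) := by rw [ZMod.val_one_eq_one_mod, hmod, iterate_one]

/-! ### The iterated gcd -/

theorem gcdRem_mul_of_coprime {t ω : ℕ} (hω : Nat.Coprime ω t) (ν j : ℕ) :
    gcdRem t (ν * ω) j = gcdRem t ν j * ω := by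
  induction j with
  | zero => rfl
  | succ j ih =>
    rw [gcdRem, gcdRem, ih, Nat.Coprime.gcd_mul_right_cancel_right _ hω,
      Nat.div_mul_right_comm (Nat.gcd_dvd_right _ _)]

theorem gcdTree_mul_of_coprime {t ω : ℕ} (hω : Nat.Coprime ω t) (ν : ℕ) :
    gcdTree t (ν * ω) = gcdTree t ν := by
  have h : gcdSeq t (ν * ω) = gcdSeq t ν := funext fun j => by
    rw [gcdSeq, gcdSeq, gcdRem_mul_of_coprime hω, Nat.Coprime.gcd_mul_right_cancel_right _ hω]
  rw [gcdTree, gcdTree, gcdLength, gcdLength, h]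

theorem gcdRem_pos (t : ℕ) {n : ℕ} (hn : 0 < n) (j : ℕ) : 0 < gcdRem t n j := by
  induction j with
  | zero => exact hn
  | succ j ih => exact Nat.div_gcd_pos_of_pos_right _ ih

theorem exists_pos_gcdSeq_eq_one (t : ℕ) {n : ℕ} (hn : 0 < n) : ∃ D, 0 < D ∧ gcdSeq t n D = 1 := by
  let rem (j : ℕ) := gcdRem t n (j + 1)
  refine ⟨argmin rem + 1, Nat.succ_pos _, by_contra fun h => ?_⟩
  have hpos : 0 < rem (argmin rem) := gcdRem_pos t hn _
  have hgcd : 1 < Nat.gcd t (rem (argmin rem)) :=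
    lt_of_le_of_ne (Nat.gcd_pos_of_pos_right t hpos) (Ne.symm h)
  exact (argmin_le rem (argmin rem + 1)).not_gt (Nat.div_lt_self hpos hgcd)

theorem gcdLength_spec (t : ℕ) {n : ℕ} (hn : 0 < n) :
    0 < gcdLength t n ∧ gcdSeq t n (gcdLength t n) = 1 :=
  Nat.sInf_mem (exists_pos_gcdSeq_eq_one t hn)

/-! ### Power maps of cyclic groups -/

theorem powerMap_iterate {G : Type*} [Group G] (t n : ℕ) (g : G) :
    (powerMap G t)^[n] g = g ^ t ^ n :=
  congrFun (pow_iterate t n) g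

theorem range_powerMap_iterate {C : Type*} [CommGroup C] (t j : ℕ) :
    Set.range (powerMap C t)^[j] = (powMonoidHom (t ^ j) : C →* C).range := by
  ext x
  simp only [Set.mem_range, powerMap_iterate, SetLike.mem_coe, MonoidHom.mem_range,
    powMonoidHom_apply]

theorem card_range_powMonoidHom_pow {C : Type*} [CommGroup C] [Finite C] [IsCyclic C] (t j : ℕ) :
    Nat.card (powMonoidHom (t ^ j) : C →* C).range = gcdRem t (Nat.card C) j := by
  induction j with
  | zero =>
    rw [pow_zero, gcdRem, IsCyclic.card_powMonoidHom_range, Nat.gcd_one_right, Nat.div_one]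
  | succ j ih =>
    let H := (powMonoidHom (t ^ j) : C →* C).range
    have hmap : (powMonoidHom (t ^ (j + 1)) : C →* C).range =
        (powMonoidHom t : H →* H).range.map H.subtype :=
      calc (powMonoidHom (t ^ (j + 1)) : C →* C).range
          = ((powMonoidHom t).comp (powMonoidHom (t ^ j))).range := by
            congr 1
            exact MonoidHom.ext fun x => (congrArg (x ^ ·) (pow_succ t j)).trans (pow_mul x _ t)
        _ = ((powMonoidHom t).comp H.subtype).range := by
            rw [MonoidHom.range_comp, MonoidHom.range_comp, H.range_subtype]
        _ = (powMonoidHom t : H →* H).range.map H.subtype :=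
          MonoidHom.range_comp H.subtype (powMonoidHom t)
    rw [hmap, Subgroup.card_map_of_injective H.subtype_injective, IsCyclic.card_powMonoidHom_range,
      Nat.gcd_comm, gcdRem, ← ih]

theorem isLevelRegular_powerMap (C : Type*) [Group C] [Finite C] [IsCyclic C] (t : ℕ) :
    IsLevelRegular (powerMap C t) (gcdSeq t (Nat.card C)) := by
  let : CommGroup C := IsCyclic.commGroup
  rintro j _ ⟨x, rfl⟩
  let H := (powMonoidHom (t ^ j) : C →* C).range
  let a : H := ⟨x ^ t ^ j, x, rfl⟩
  have hfiber : powerMap C t ⁻¹' {(powerMap C t)^[j + 1] x} ∩ Set.range (powerMap C t)^[j] =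
      Subtype.val '' ((powMonoidHom t : H →* H) ⁻¹' {powMonoidHom t a}) := by
    ext y
    rw [range_powerMap_iterate, iterate_succ_apply', powerMap_iterate]
    constructor
    · rintro ⟨hy, hyH⟩
      exact ⟨⟨y, hyH⟩, Subtype.ext hy, rfl⟩
    · rintro ⟨y, hy, rfl⟩
      exact ⟨congrArg Subtype.val hy, y.2⟩
  rw [hfiber, Set.ncard_image_of_injective _ Subtype.val_injective, ← Nat.card_coe_set_eq,
    Nat.card_congr (MonoidHom.fiberEquivKer _ a), IsCyclic.card_powMonoidHom_ker,
    card_range_powMonoidHom_pow, Nat.gcd_comm, gcdSeq]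

theorem gcdTree_card_realizes (C : Type*) [Group C] [Finite C] [IsCyclic C] (t : ℕ) :
    (gcdTree t (Nat.card C)).Realizes (powerMap C t) 1 (backwardOrbit (powerMap C t) 1) :=
  have h := gcdLength_spec t (Nat.card_pos (α := C))
  (isLevelRegular_powerMap C t).elementaryTree_realizes (one_pow t) h.1 h.2

/-! ### Regular parts -/

section

variable {S W : Type*} {f : S → S} {f' : W → W} {r : S} {X : Set S} {T : RTree} {m : ℕ}

theorem copies_cyc_prod_realizes [Finite W] (hT : T.Realizes f r X) (hr : IsFixedPt f r)
    (hX : X ⊆ backwardOrbit f r) (hm : 0 < m) (hf' : ∀ w, minimalPeriod f' w = m) :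
    Realizes (copies (Nat.card W / m) (cyc m T)) (Prod.map f f')
      (X ×ˢ Set.univ) := by
  obtain ⟨o, ho⟩ := exists_equiv_prod_zmod hm hf'
  obtain ⟨F, hF, hroot, hadj, rfl⟩ := hT
  have hleave : ∀ x y, T.graph.Adj x y →
      (hittingTime f r (F x) : ZMod m) = hittingTime f r (F y) + 1 := fun x y hxy => by
    have hx : F x ≠ r := fun h => T.root_sink y (hF (h.trans hroot.symm) ▸ hxy)
    rw [hittingTime_eq_add_one (hX ⟨x, rfl⟩) hx, hadj x y hxy, Nat.cast_add_one]
  -- A vertex at distance `δ` from the root of the tree behind `o (i, a)` must be paired with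
  -- `o (i, a - δ)`, so that both coordinates arrive at `(r, o (i, a))` after `δ` steps.
  refine ⟨fun x => (exists_cyc_adj m T x.2).imp' (Prod.mk x.1) fun _ hy => ⟨rfl, hy⟩,
    fun p => (F p.2.2, o (p.1, p.2.1 - hittingTime f r (F p.2.2))), ?_, ?_, ?_⟩
  · rintro ⟨i, a, x⟩ ⟨j, b, y⟩ h
    obtain ⟨hxy, hab⟩ := Prod.mk.inj h
    obtain rfl : x = y := hF hxy
    obtain ⟨rfl, hab⟩ := Prod.mk.inj (o.injective hab)
    obtain rfl : a = b := sub_left_injective hab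
    rfl
  · rintro ⟨i, a, x⟩ ⟨_, b, y⟩ ⟨rfl, ⟨rfl, hxy⟩ | ⟨rfl, rfl, rfl⟩⟩
    · refine Prod.ext (hadj x y hxy) ((ho i _).symm.trans ?_)
      dsimp only
      rw [hleave x y hxy, sub_add_eq_sub_sub, sub_add_cancel]
    · refine Prod.ext ((congrArg f hroot).trans (hr.trans hroot.symm)) ((ho i _).symm.trans ?_)
      dsimp only
      rw [sub_add_eq_add_sub]
  · ext ⟨s, w⟩
    constructor
    · rintro ⟨⟨i, a, x⟩, h⟩
      exact ⟨⟨x, congrArg Prod.fst h⟩, trivial⟩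
    · rintro ⟨⟨x, rfl⟩, -⟩
      obtain ⟨⟨i, a⟩, rfl⟩ := o.surjective w
      exact ⟨(i, a + hittingTime f r (F x), x), by dsimp only; rw [add_sub_cancel_right]⟩

end

section

variable {G : Type*} [Group G] {t : ℕ}

theorem powerMap_mul {x y : G} (h : Commute x y) (t : ℕ) :
    powerMap G t (x * y) = powerMap G t x * powerMap G t y := h.mul_pow t

theorem minimalPeriod_powerMap (t : ℕ) (w : G) :
    minimalPeriod (powerMap G t) w = ordMod (orderOf w) t := by
  refine minimalPeriod_eq_minimalPeriod_iff.mpr fun n => ?_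
  rw [isPeriodicPt_mul_iff_pow_eq_one, IsPeriodicPt, IsFixedPt, powerMap_iterate]
  calc w ^ t ^ n = w ↔ w ^ t ^ n = w ^ 1 := by rw [pow_one]
    _ ↔ ((t ^ n : ℕ) : ZMod (orderOf w)) = (1 : ℕ) := by
      rw [pow_eq_pow_iff_modEq, ZMod.natCast_eq_natCast_iff]
    _ ↔ (t : ZMod (orderOf w)) ^ n = 1 := by rw [Nat.cast_pow, Nat.cast_one]

theorem ordMod_pos_iff {d : ℕ} (hd : 0 < d) : 0 < ordMod d t ↔ Nat.Coprime d t := by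
  have : NeZero d := ⟨hd.ne'⟩
  rw [ordMod, orderOf_pos_iff, isOfFinOrder_iff_isUnit, ZMod.isUnit_iff_coprime, Nat.coprime_comm]

/-- The `t`-regular part of an element `g` of a finite group: the power of `g` with exponent
`t ^ (#G)!`. Its order is prime to `t`, whereas some power `t ^ n` annihilates
`g * (regularPart t g)⁻¹`. -/
noncomputable def regularPart (t : ℕ) : G → G := recurrentPart (powerMap G t)

theorem regularPart_eq_pow (t : ℕ) (g : G) : regularPart t g = g ^ t ^ (Nat.card G).factorial :=
  powerMap_iterate t _ g

theorem regularPart_mem {H : Subgroup G} {g : G} (hg : g ∈ H) : regularPart t g ∈ H :=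
  regularPart_eq_pow t g ▸ H.pow_mem hg _

theorem regularPart_mul {x y : G} (h : Commute x y) :
    regularPart t (x * y) = regularPart t x * regularPart t y := by
  simp only [regularPart_eq_pow, h.mul_pow]

theorem regularPart_inv (x : G) : regularPart t x⁻¹ = (regularPart t x)⁻¹ := by
  simp only [regularPart_eq_pow, inv_pow]

variable [Finite G]

theorem regularPart_eq_self_iff {x : G} : regularPart t x = x ↔ Nat.Coprime (orderOf x) t := by
  rw [regularPart, recurrentPart_eq_self_iff, ← minimalPeriod_pos_iff_mem_periodicPts,
    minimalPeriod_powerMap, ordMod_pos_iff (orderOf_pos x)]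

theorem coprime_orderOf_regularPart (t : ℕ) (x : G) : Nat.Coprime (orderOf (regularPart t x)) t :=
  regularPart_eq_self_iff.mp <|
    recurrentPart_eq_self_iff.mpr (recurrentPart_mem_periodicPts (powerMap G t) x)

theorem regularPart_eq_one_iff {x : G} :
    regularPart t x = 1 ↔ x ∈ backwardOrbit (powerMap G t) 1 :=
  recurrentPart_eq_iff_mem_backwardOrbit (one_pow t)

theorem mul_inv_regularPart_mem_backwardOrbit (t : ℕ) (g : G) :
    g * (regularPart t g)⁻¹ ∈ backwardOrbit (powerMap G t) 1 := by
  have hcomm : Commute g (regularPart t g)⁻¹ := by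
    rw [regularPart_eq_pow]
    exact (Commute.self_pow g _).inv_right
  rw [← regularPart_eq_one_iff, regularPart_mul hcomm, regularPart_inv,
    regularPart_eq_self_iff.mpr (coprime_orderOf_regularPart t g), mul_inv_cancel]

end

/-! ### Cycles of power maps -/

theorem minimalPeriod_restrict {S : Type*} {f : S → S} {W : Set S} (hW : Set.MapsTo f W W)
    (w : W) : minimalPeriod hW.restrict w = minimalPeriod f w := by
  refine minimalPeriod_eq_minimalPeriod_iff.mpr fun n => ?_
  rw [IsPeriodicPt, IsFixedPt, IsPeriodicPt, IsFixedPt, Subtype.ext_iff, hW.coe_iterate_restrict]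

section

variable {G : Type*} [Group G] {t : ℕ}

theorem ncard_orderOf_eq (C : Subgroup G) [Finite C] [IsCyclic C] {d : ℕ} (hd : d ∣ Nat.card C) :
    {w | w ∈ C ∧ orderOf w = d}.ncard = Nat.totient d := by
  have := Fintype.ofFinite C
  rw [Nat.card_eq_fintype_card] at hd
  rw [← IsCyclic.card_orderOf_eq_totient hd, ← Set.ncard_coe_finset,
    ← Set.ncard_image_of_injective _ Subtype.val_injective]
  congr 1
  ext w
  simp [and_comm]

theorem mapsTo_powerMap_orderOf_eq (C : Subgroup G) {d : ℕ} (hdt : Nat.Coprime d t) :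
    Set.MapsTo (powerMap G t) {w | w ∈ C ∧ orderOf w = d} {w | w ∈ C ∧ orderOf w = d} := by
  rintro w ⟨hw, rfl⟩
  exact ⟨C.pow_mem hw t, hdt.orderOf_pow⟩

variable [Finite G]

theorem regularPart_mul_eq_right {x w : G} (hx : x ∈ backwardOrbit (powerMap G t) 1)
    (hw : Nat.Coprime (orderOf w) t) (h : Commute x w) : regularPart t (x * w) = w := by
  rw [regularPart_mul h, regularPart_eq_one_iff.mpr hx, regularPart_eq_self_iff.mpr hw, one_mul]

variable {T : RTree} {U : Set G} {C : Subgroup G}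

theorem image_mul_eq_preimage_regularPart {W : Set G}
    (hU : U ⊆ backwardOrbit (powerMap G t) 1) (hW : ∀ w ∈ W, Nat.Coprime (orderOf w) t)
    (hcomm : ∀ x ∈ U, ∀ w ∈ W, Commute x w)
    (hmem : ∀ g, regularPart t g ∈ W → g * (regularPart t g)⁻¹ ∈ U) :
    (fun p : G × W => p.1 * p.2) '' (U ×ˢ Set.univ) = regularPart t ⁻¹' W := by
  ext g
  constructor
  · rintro ⟨⟨x, w⟩, ⟨hx, -⟩, rfl⟩
    rw [Set.mem_preimage, regularPart_mul_eq_right (hU hx) (hW w w.2) (hcomm x hx w w.2)]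
    exact w.2
  · exact fun hg => ⟨(_, ⟨_, hg⟩), ⟨hmem g hg, trivial⟩, inv_mul_cancel_right _ _⟩

theorem injOn_mul_of_coprime_orderOf {W : Set G}
    (hU : U ⊆ backwardOrbit (powerMap G t) 1) (hW : ∀ w ∈ W, Nat.Coprime (orderOf w) t)
    (hcomm : ∀ x ∈ U, ∀ w ∈ W, Commute x w) :
    Set.InjOn (fun p : G × W => p.1 * p.2) (U ×ˢ Set.univ) := by
  rintro ⟨x, w⟩ ⟨hx, -⟩ ⟨y, z⟩ ⟨hy, -⟩ (h : x * w = y * z)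
  have hwz : (w : G) = z :=
    calc (w : G) = regularPart t (x * w) :=
          (regularPart_mul_eq_right (hU hx) (hW w w.2) (hcomm x hx w w.2)).symm
      _ = regularPart t (y * z) := by rw [h]
      _ = z := regularPart_mul_eq_right (hU hy) (hW z z.2) (hcomm y hy z z.2)
  rw [hwz] at h
  exact Prod.ext (mul_right_cancel h) (Subtype.ext hwz)

theorem cycleBlock_realizes [IsCyclic C] (hT : T.Realizes (powerMap G t) 1 U)
    (hU : U ⊆ backwardOrbit (powerMap G t) 1) (hcomm : ∀ x ∈ U, ∀ w ∈ C, Commute x w) {d : ℕ}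
    (hd : d ∣ Nat.card C) (hdt : Nat.Coprime d t)
    (hmem : ∀ g, regularPart t g ∈ C → orderOf (regularPart t g) = d →
      g * (regularPart t g)⁻¹ ∈ U) :
    Realizes (cycleBlock t d T) (powerMap G t)
      (regularPart t ⁻¹' {w | w ∈ C ∧ orderOf w = d}) := by
  have hW := mapsTo_powerMap_orderOf_eq C hdt
  have hcop : ∀ w ∈ {w | w ∈ C ∧ orderOf w = d}, Nat.Coprime (orderOf w) t :=
    fun w hw => hw.2 ▸ hdt
  have hcomm' : ∀ x ∈ U, ∀ w ∈ {w | w ∈ C ∧ orderOf w = d}, Commute x w :=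
    fun x hx w hw => hcomm x hx w hw.1
  have hm : 0 < ordMod d t := (ordMod_pos_iff (Nat.pos_of_dvd_of_pos hd Nat.card_pos)).mpr hdt
  have hper : ∀ w, minimalPeriod hW.restrict w = ordMod d t := fun w => by
    rw [minimalPeriod_restrict, minimalPeriod_powerMap, w.2.2]
  have key := (copies_cyc_prod_realizes hT (one_pow t) hU hm hper).map (f' := powerMap G t)
    (injOn_mul_of_coprime_orderOf hU hcop hcomm')
    fun p hp => (powerMap_mul (hcomm p.1 hp.1 _ p.2.2.1) t).symm
  rwa [image_mul_eq_preimage_regularPart hU hcop hcomm' fun g hg => hmem g hg.1 hg.2,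
    Nat.card_coe_set_eq, ncard_orderOf_eq C hd] at key

theorem disjUnionFamily_cycleBlock_realizes [IsCyclic C]
    (hT : T.Realizes (powerMap G t) 1 U) (hU : U ⊆ backwardOrbit (powerMap G t) 1)
    (hcomm : ∀ x ∈ U, ∀ w ∈ C, Commute x w) {p : ℕ → Prop}
    (hp : ∀ d, p d → d ∣ Nat.card C ∧ Nat.Coprime d t)
    (hmem : ∀ g, regularPart t g ∈ C → p (orderOf (regularPart t g)) →
      g * (regularPart t g)⁻¹ ∈ U) :
    Realizes (disjUnionFamily fun d : {d // p d} => cycleBlock t d T) (powerMap G t)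
      (regularPart t ⁻¹' {w | w ∈ C ∧ p (orderOf w)}) := by
  have key := Realizes.disjUnionFamily (A := fun d : {d // p d} => cycleBlock t d T)
    (fun d => cycleBlock_realizes hT hU hcomm (hp d d.2).1 (hp d d.2).2
      fun g hg hgd => hmem g hg (hgd ▸ d.2))
    fun d e hde => Set.disjoint_left.mpr fun g hd he => hde (Subtype.ext (hd.2.symm.trans he.2))
  convert key
  ext g
  simp

end

/-! ### Coprime parts and cyclic subgroups -/

namespace IsCoprimePart

variable {t c ν ω : ℕ}

theorem dvd_iff (hω : IsCoprimePart t c ω) (hc : 0 < c) {d : ℕ} (hd : Nat.Coprime d t) :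
    d ∣ ω ↔ d ∣ c := by
  refine ⟨fun h => h.trans hω.1.1, fun h => ?_⟩
  have hlcm : Nat.lcm d ω ∣ c := Nat.lcm_dvd h hω.1.1
  have hle : Nat.lcm d ω ≤ ω := hω.2
    ⟨hlcm, Nat.Coprime.coprime_dvd_left (Nat.lcm_dvd_mul d ω) (hd.mul_left hω.1.2)⟩
  have heq : Nat.lcm d ω = ω := hle.antisymm <|
    Nat.le_of_dvd (Nat.pos_of_dvd_of_pos hlcm hc) (Nat.dvd_lcm_right d ω)
  exact heq ▸ Nat.dvd_lcm_left d ω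

theorem exists_dvd_pow (hω : IsCoprimePart t (ν * ω) ω) (h : 0 < ν * ω) : ∃ n, ν ∣ t ^ n := by
  rcases t.eq_zero_or_pos with rfl | ht
  · exact ⟨1, dvd_zero ν⟩
  refine (Nat.exists_dvd_pow_iff (Nat.pos_of_mul_pos_right h).ne' ht.ne').mpr fun p hp => ?_
  obtain ⟨hp, hpν, -⟩ := Nat.mem_primeFactors.mp hp
  refine Nat.mem_primeFactors.mpr ⟨hp, ?_, ht.ne'⟩
  by_contra hpt
  have hcop : Nat.Coprime (p * ω) t := ((hp.coprime_iff_not_dvd).mpr hpt).mul_left hω.1.2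
  have hdvd : p * ω ∣ ω := (hω.dvd_iff h hcop).mpr (Nat.mul_dvd_mul_right hpν ω)
  have hω₀ : 0 < ω := Nat.pos_of_mul_pos_left h
  exact (Nat.le_of_dvd hω₀ hdvd).not_gt (lt_mul_of_one_lt_left hω₀ hp.one_lt)

end IsCoprimePart

section

variable {G : Type*} [Group G] {t ν ω : ℕ}

theorem commute_of_mem_isCyclic {C : Subgroup G} [IsCyclic C] {x y : G} (hx : x ∈ C)
    (hy : y ∈ C) : Commute x y := by
  let : CommGroup C := IsCyclic.commGroup
  exact congrArg Subtype.val (mul_comm (⟨x, hx⟩ : C) ⟨y, hy⟩)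

theorem gcdTree_realizes (C : Subgroup G) [Finite C] [IsCyclic C] (hC : Nat.card C = ν * ω)
    (hω : Nat.Coprime ω t) :
    (gcdTree t ν).Realizes (powerMap G t) 1 (C ∩ backwardOrbit (powerMap G t) 1) := by
  have h : (C ∩ backwardOrbit (powerMap G t) 1 : Set G) =
      Subtype.val '' backwardOrbit (powerMap C t) 1 := by
    ext y
    simp only [backwardOrbit, powerMap_iterate]
    constructor
    · rintro ⟨hy, n, hn⟩
      exact ⟨⟨y, hy⟩, ⟨n, Subtype.ext hn⟩, rfl⟩
    · rintro ⟨y, ⟨n, hn⟩, rfl⟩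
      exact ⟨y.2, n, congrArg Subtype.val hn⟩
  rw [← gcdTree_mul_of_coprime hω ν, ← hC, h]
  exact (gcdTree_card_realizes C t).map Subtype.val_injective fun _ => rfl

theorem ncard_pow_eq_one (C : Subgroup G) [Finite C] [IsCyclic C] (n : ℕ) :
    {y | y ∈ C ∧ y ^ n = 1}.ncard = Nat.gcd (Nat.card C) n := by
  let : CommGroup C := IsCyclic.commGroup
  have h : {y | y ∈ C ∧ y ^ n = 1} = ((powMonoidHom n : C →* C).ker.map C.subtype : Set G) := by
    ext y
    simp [MonoidHom.mem_ker, Subtype.ext_iff, and_comm]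
  rw [h, ← IsCyclic.card_powMonoidHom_ker C n, ← Nat.card_coe_set_eq]
  exact Subgroup.card_map_of_injective C.subtype_injective

variable {C : Subgroup G} [Finite C] [IsCyclic C]

theorem mem_iff_orderOf_dvd_card {H : Subgroup G} (hH : H ≤ C) {x : G} (hx : x ∈ C) :
    x ∈ H ↔ orderOf x ∣ Nat.card H := by
  refine ⟨H.orderOf_dvd_natCard, fun h => ?_⟩
  have hsub : (H : Set G) ⊆ {y | y ∈ C ∧ y ^ Nat.card H = 1} := fun y hy =>
    ⟨hH hy, orderOf_dvd_iff_pow_eq_one.mp (H.orderOf_dvd_natCard hy)⟩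
  have hfin : {y | y ∈ C ∧ y ^ Nat.card H = 1}.Finite :=
    (Set.toFinite (C : Set G)).subset fun y hy => hy.1
  have hle : {y | y ∈ C ∧ y ^ Nat.card H = 1}.ncard ≤ (H : Set G).ncard := by
    rw [ncard_pow_eq_one, Nat.gcd_eq_right (Subgroup.card_dvd_of_le hH)]
    exact (Nat.card_coe_set_eq (H : Set G)).le
  rw [← SetLike.mem_coe, Set.eq_of_subset_of_ncard_le hsub hle hfin]
  exact ⟨hx, orderOf_dvd_iff_pow_eq_one.mp h⟩

theorem mem_iff_orderOf_dvd_of_coprime {H : Subgroup G} (hH : H ≤ C)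
    (hω : IsCoprimePart t (Nat.card H) ω) {x : G} (hx : x ∈ C) (hxt : Nat.Coprime (orderOf x) t) :
    x ∈ H ↔ orderOf x ∣ ω := by
  have : Finite H := Finite.of_injective _ (Subgroup.inclusion_injective hH)
  rw [mem_iff_orderOf_dvd_card hH hx, hω.dvd_iff Nat.card_pos hxt]

theorem ncard_inter_backwardOrbit_one (hω : IsCoprimePart t (Nat.card C) ω)
    (hC : Nat.card C = ν * ω) : (C ∩ backwardOrbit (powerMap G t) 1 : Set G).ncard = ν := by
  obtain ⟨n, hn⟩ := (hC ▸ hω).exists_dvd_pow (hC ▸ Nat.card_pos)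
  have h : (C ∩ backwardOrbit (powerMap G t) 1 : Set G) = {y | y ∈ C ∧ y ^ ν = 1} := by
    ext y
    refine and_congr_right fun hy => ?_
    simp only [backwardOrbit, Set.mem_ofPred_eq, powerMap_iterate, ← orderOf_dvd_iff_pow_eq_one]
    refine ⟨fun ⟨m, hm⟩ => ?_, fun hy => ⟨n, hy.trans hn⟩⟩
    exact ((hω.1.2.symm.pow_left m).coprime_dvd_left hm).dvd_of_dvd_mul_right
      (hC ▸ C.orderOf_dvd_natCard hy)
  rw [h, ncard_pow_eq_one, hC, Nat.gcd_eq_right (Nat.dvd_mul_right ν ω)]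

end

/-! ### Petals -/

namespace IsFlower

variable {G : Type*} [Group G] {t k : ℕ} {C₀ : Subgroup G} {C : Fin k → Subgroup G}

theorem isCyclic_petal (h : IsFlower C₀ C) (i : Fin k) : IsCyclic (C i) :=
  ((h.petal_iff _).mpr ⟨i, rfl⟩).1

theorem exists_mem_petal (h : IsFlower C₀ C) (g : G) : ∃ i, g ∈ C i := by
  have := h.finite
  obtain ⟨M, hM, hmax⟩ := (Set.toFinite {H : Subgroup G | IsCyclic H}).exists_le_maximal
    (inferInstance : IsCyclic (Subgroup.zpowers g))
  obtain ⟨i, rfl⟩ := (h.petal_iff M).mp ⟨hmax.1, fun H hH hle => (hmax.2 hH hle).antisymm hle⟩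
  exact ⟨i, hM (Subgroup.mem_zpowers g)⟩

theorem exists_ne (h : IsFlower C₀ C) (i : Fin k) : ∃ j, j ≠ i := by
  by_contra! hall
  have := h.isCyclic_petal i
  refine h.not_cyclic (isCyclic_of_surjective (C i).subtype fun g => ?_)
  obtain ⟨j, hj⟩ := h.exists_mem_petal g
  exact ⟨⟨g, hall j ▸ hj⟩, rfl⟩

theorem pistil_le_petal (h : IsFlower C₀ C) (i : Fin k) : C₀ ≤ C i := by
  obtain ⟨j, hj⟩ := h.exists_ne i
  rw [← h.inter j i hj]
  exact inf_le_right

theorem isCyclic_pistil (h : IsFlower C₀ C) : IsCyclic C₀ := by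
  obtain ⟨i, -⟩ := h.exists_mem_petal 1
  have := h.isCyclic_petal i
  exact Subgroup.isCyclic_of_le (h.pistil_le_petal i)

theorem commute_of_mem_pistil (h : IsFlower C₀ C) (x : G) {w : G} (hw : w ∈ C₀) :
    Commute x w := by
  obtain ⟨i, hi⟩ := h.exists_mem_petal x
  have := h.isCyclic_petal i
  exact commute_of_mem_isCyclic hi (h.pistil_le_petal i hw)

theorem pairwise_disjoint_petal_sdiff (h : IsFlower C₀ C) :
    Pairwise (Disjoint on fun i => (C i \ C₀ : Set G)) := fun i j hij =>
  Set.disjoint_left.mpr fun _ hi hj => hi.2 (h.inter i j hij ▸ ⟨hi.1, hj.1⟩)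

theorem iUnion_petal_sdiff (h : IsFlower C₀ C) : ⋃ i, (C i \ C₀ : Set G) = (C₀ : Set G)ᶜ := by
  ext g
  obtain ⟨i, hi⟩ := h.exists_mem_petal g
  rw [Set.mem_iUnion]
  exact ⟨fun ⟨_, hg⟩ => hg.2, fun hg => ⟨i, hi, hg⟩⟩

theorem ncard_sdiff_pistil (h : IsFlower C₀ C) (P : Set G) :
    (P \ C₀).ncard = ∑ i, ((C i ∩ P) \ C₀ : Set G).ncard := by
  have := h.finite
  have hP : P \ C₀ = ⋃ i, ((C i ∩ P) \ C₀ : Set G) := by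
    simp only [← Set.sdiff_inter_right_comm, ← Set.iUnion_inter, h.iUnion_petal_sdiff]
    rw [Set.inter_comm, Set.sdiff_eq]
  have hdisj : Pairwise (Disjoint on fun i => ((C i ∩ P) \ C₀ : Set G)) := fun i j hij =>
    (h.pairwise_disjoint_petal_sdiff hij).mono (Set.sdiff_subset_sdiff_left Set.inter_subset_left)
      (Set.sdiff_subset_sdiff_left Set.inter_subset_left)
  rw [hP, Set.ncard_iUnion_of_finite (fun i => Set.toFinite _) hdisj, finsum_eq_sum_of_fintype]

theorem ncard_eq_sum (h : IsFlower C₀ C) (P : Set G) :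
    (P.ncard : ℤ) = ∑ i, ((C i ∩ P : Set G).ncard : ℤ) -
      ((k : ℤ) - 1) * (C₀ ∩ P : Set G).ncard := by
  have := h.finite
  have hsplit (Q : Set G) (hQ : (C₀ ∩ P : Set G) = (C₀ ∩ Q : Set G)) :
      (Q.ncard : ℤ) = (Q \ C₀).ncard + (C₀ ∩ P : Set G).ncard := by
    rw [hQ, Set.inter_comm, add_comm]
    exact_mod_cast (Set.ncard_inter_add_ncard_sdiff_eq_ncard Q C₀).symm
  have hpetal (i : Fin k) : ((C i ∩ P : Set G).ncard : ℤ) =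
      ((C i ∩ P) \ C₀ : Set G).ncard + (C₀ ∩ P : Set G).ncard :=
    hsplit _ <| by rw [← Set.inter_assoc, Set.inter_eq_left.mpr (h.pistil_le_petal i)]
  simp only [hpetal, Finset.sum_add_distrib, Finset.sum_const, Finset.card_univ,
    Fintype.card_fin, nsmul_eq_mul]
  rw [hsplit P rfl, h.ncard_sdiff_pistil, Nat.cast_sum]
  ring

theorem petal_realizes (h : IsFlower C₀ C) {ω₀ : ℕ}
    (hω₀ : IsCoprimePart t (Nat.card C₀) ω₀) {i : Fin k} {ν ω : ℕ}
    (hω : IsCoprimePart t (Nat.card (C i)) ω) (hc : Nat.card (C i) = ν * ω) :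
    Realizes (disjUnionFamily fun d : {d // d ∣ ω ∧ ¬ d ∣ ω₀} => cycleBlock t d (gcdTree t ν))
      (powerMap G t) (regularPart t ⁻¹' (C i \ C₀)) := by
  have := h.finite
  have := h.isCyclic_petal i
  have hcop (g : G) := coprime_orderOf_regularPart t g
  have hpistil : ∀ g, regularPart t g ∈ C i →
      (regularPart t g ∈ C₀ ↔ orderOf (regularPart t g) ∣ ω₀) := fun g hg =>
    mem_iff_orderOf_dvd_of_coprime (h.pistil_le_petal i) hω₀ hg (hcop g)
  have hset : regularPart t ⁻¹' (C i \ C₀) =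
      regularPart t ⁻¹' {w | w ∈ C i ∧ orderOf w ∣ ω ∧ ¬ orderOf w ∣ ω₀} := by
    ext g
    refine and_congr_right fun hg => ?_
    have hgω := (mem_iff_orderOf_dvd_of_coprime le_rfl hω hg (hcop g)).mp hg
    exact (hpistil g hg).not.trans (and_iff_right hgω).symm
  rw [hset]
  refine disjUnionFamily_cycleBlock_realizes (gcdTree_realizes (C i) hc hω.1.2)
    Set.inter_subset_right (fun x hx w hw => commute_of_mem_isCyclic hx.1 hw)
    (fun d hd => ⟨hd.1.trans hω.1.1, hω.1.2.coprime_dvd_left hd.1⟩) fun g hg hgd => ?_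
  obtain ⟨j, hj⟩ := h.exists_mem_petal g
  have hij : j = i := h.pairwise_disjoint_petal_sdiff.eq <| Set.not_disjoint_iff.mpr
    ⟨regularPart t g, ⟨regularPart_mem hj, (hpistil g hg).not.mpr hgd.2⟩,
      hg, (hpistil g hg).not.mpr hgd.2⟩
  exact ⟨(C i).mul_mem (hij ▸ hj) ((C i).inv_mem hg), mul_inv_regularPart_mem_backwardOrbit t g⟩

theorem pistil_realizes (h : IsFlower C₀ C) {ω₀ : ℕ} (hω₀ : IsCoprimePart t (Nat.card C₀) ω₀) :
    Realizes (disjUnionFamily fun d : {d // d ∣ ω₀} => cycleBlock t d (centralTree t G))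
      (powerMap G t) (regularPart t ⁻¹' C₀) := by
  have := h.finite
  have := h.isCyclic_pistil
  have hset : regularPart t ⁻¹' C₀ = regularPart t ⁻¹' {w | w ∈ C₀ ∧ orderOf w ∣ ω₀} := by
    ext g
    refine (and_iff_left_of_imp fun hg => ?_).symm
    exact (mem_iff_orderOf_dvd_of_coprime le_rfl hω₀ hg (coprime_orderOf_regularPart t g)).mp hg
  rw [hset]
  exact disjUnionFamily_cycleBlock_realizes (attachedTree_realizes (one_pow t)) subset_rfl
    (fun x _ w hw => h.commute_of_mem_pistil x hw)
    (fun d hd => ⟨hd.trans hω₀.1.1, hω₀.1.2.coprime_dvd_left hd⟩)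
    fun g _ _ => mul_inv_regularPart_mem_backwardOrbit t g

end IsFlower

end FlowerGroup

open FlowerGroup

theorem mainTheorem1 {G : Type*} [Group G] (t : ℕ) (ht : 0 < t) {k : ℕ}
    (c₀ : ℕ) (c : Fin k → ℕ) (hG : FlowerGroup.IsFlowerGroupOfType G c₀ c)
    (ν₀ ω₀ : ℕ) (hω₀ : FlowerGroup.IsCoprimePart t c₀ ω₀) (hc₀ : c₀ = ν₀ * ω₀)
    (ν ω : Fin k → ℕ) (hω : ∀ i, FlowerGroup.IsCoprimePart t (c i) (ω i))
    (hc : ∀ i, c i = ν i * ω i) :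
    FlowerGroup.Isomorphic
      (FlowerGroup.functionalGraph (FlowerGroup.powerMap G t))
      (FlowerGroup.disjUnion
        (FlowerGroup.disjUnionFamily fun i : Fin k =>
          FlowerGroup.disjUnionFamily fun d : {d : ℕ // d ∣ ω i ∧ ¬ d ∣ ω₀} =>
            FlowerGroup.cycleBlock t d.1 (FlowerGroup.gcdTree t (ν i)))
        (FlowerGroup.disjUnionFamily fun d : {d : ℕ // d ∣ ω₀} =>
          FlowerGroup.cycleBlock t d.1 (FlowerGroup.centralTree t G))) ∧
    (Nat.card (FlowerGroup.centralTree t G).V : ℤ) =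
      (∑ i, (ν i : ℤ)) - ((k : ℤ) - 1) * (ν₀ : ℤ) := by
  obtain ⟨C₀, C, hfl, rfl, hcard⟩ := hG
  obtain rfl : (fun i => Nat.card (C i)) = c := funext hcard
  have := hfl.finite
  have := hfl.isCyclic_pistil
  have := hfl.isCyclic_petal
  constructor
  · have hpetals := Realizes.disjUnionFamily (fun i => hfl.petal_realizes hω₀ (hω i) (hc i))
      fun i j hij => (hfl.pairwise_disjoint_petal_sdiff hij).preimage (regularPart t)
    have key := hpetals.disjUnion (hfl.pistil_realizes hω₀) <| by
      rw [← Set.preimage_iUnion, hfl.iUnion_petal_sdiff]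
      exact disjoint_compl_left.preimage _
    rw [← Set.preimage_iUnion, hfl.iUnion_petal_sdiff, ← Set.preimage_union,
      Set.compl_union_self, Set.preimage_univ] at key
    exact key.isomorphic
  · have hcentral : Nat.card (centralTree t G).V = (backwardOrbit (powerMap G t) 1).ncard :=
      (attachedTree_realizes (f := powerMap G t) (one_pow t)).card_eq
    rw [hcentral, hfl.ncard_eq_sum, ncard_inter_backwardOrbit_one hω₀ hc₀]
    simp only [fun i => ncard_inter_backwardOrbit_one (hω i) (hc i)]
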